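/- Let $k=\mathbb F_q$ be a finite field and let $K$ be a field of characteristic $0$ with a multiplicative norm $\|\cdot\|$ (for instance $K=\mathbb Q_p$ with $p\mid q$, or $K=\mathbb R$). Let $W(K)=1+tK[[t]]$ be the Witt ring: its addition is the product of power series, and its product $\star$ is the one with $(1-at)^{-1}\star(1-bt)^{-1}=(1-abt)^{-1}$, i.e. the coordinatewise product of the ghost coordinates $\alpha_r$, where $\alpha=\exp(\sum_{r\ge1}\alpha_r t^r/r)$ and $g(\alpha)=t\alpha'/\alpha=\sum_{r\ge 1}\alpha_rt^r$. Let $\circledast$ be the convolution product on $W(K)$ defined by $g(\alpha\circledast\gamma)=g(\alpha)g(\gamma)$ (product of power series). For $c\in K^\times$ not a root of unity, let $\mathcal T_c$ be the $c$-integral on $tK[[t]]$, that is, the linear operator given by $t^n\mapsto \frac{c^n}{1-c^n}t^n$ for $n\geq 1$ (formally $f(t)\mapsto\sum_{m\ge1}f(c^mt)$), and let $\mathcal T_{W,c}$ be the operator on $W(K)$ with $g(\mathcal T_{W,c}(\alpha))=\mathcal T_c(g(\alpha))$. For a scheme $X$ of finite type over $k$ let $Z(X,t)=\exp\left(\sum_{r\ge1}\#X(\mathbb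 F_{q^r})\,t^r/r\right)\in W(K)$. Let $K_0$ be the Grothendieck ring of schemes of finite type over $k$: it is generated by isomorphism classes $[X]$, with the relations $[X]=[Y]+[X\smallsetminus Y]$ for $Y\subset X$ closed, $[X\times Y]=[X][Y]$ and $[\mathrm{Spec}\,k]=1$. Let $\mathbb L=[\mathbb A^1]$ be the Lefschetz motive, and $\mathbb L^{-1}$, the Tate motive, its formal inverse in $K_0[\mathbb L^{-1}]$. Then: 1. $\mathcal T_{W,q}$ and $\mathcal T_{W,q^{-1}}$ are Rota--Baxter operators of weight $+1$ on $W(K)$ with respect to $\circledast$: they are additive for the Witt addition $+_W$ and satisfy $\mathcal T(\alpha)\circledast\mathcal T(\gamma)=\mathcal T(\alpha\circledast\mathcal T(\gamma))+_W\mathcal T(\mathcal T(\alpha)\circledast\gamma)+_W\mathcal T(\alpha\circledast\gamma)$. 2. There is a unique ring homomorphism $Z(\cdot,t):K_0[\mathbb L^{-1}]\to W(K)$ with $Z([X],t)=Z(X,t)$ for every scheme $X$ of finite type over $k$. 3. For every scheme $X$ of finite type over $k$, $$\mathcal T_{W,q}(Z(X,t))=\prod_{m\ge1}Z([X]\mathbb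 L^m,t)\quad\text{if }\|q\|<1,\qquad \mathcal T_{W,q^{-1}}(Z(X,t))=\prod_{m\ge1}Z([X]\mathbb L^{-m},t)\quad\text{if }\|q\|>1,$$ where the infinite products of power series converge unconditionally for the topology of coefficientwise convergence on $K[[t]]$. -/

import Mathlib

open CategoryTheory AlgebraicGeometry PowerSeries
open scoped PowerSeries.WithPiTopology

universe u v

namespace WittZeta

noncomputable section

/-! ### The Witt ring `W(K) = 1 + t K[[t]]` over a field of characteristic zero -/

/-- The underlying set `1 + t K[[t]]` of the (big) Witt ring of `K`. -/
@[ext]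
structure Witt (K : Type v) [Field K] where
  /-- the power series -/
  series : K⟦X⟧
  /-- it has constant term `1` -/
  constantCoeff_series : constantCoeff series = 1

namespace Witt

variable {K : Type v} [Field K]

/-- The ghost series `g(α) = t α' / α = ∑_{r ≥ 1} α_r t^r`, whose coefficients are the
ghost coordinates of `α`. -/
def ghost (α : Witt K) : K⟦X⟧ := X * d⁄dX K α.series * α.series⁻¹

/-- The Witt addition is the product of power series. -/
instance : Add (Witt K) := ⟨fun α β => ⟨α.series * β.series, by
  simp [α.constantCoeff_series, β.constantCoeff_series]⟩⟩

/-- The Witt zero is the power series `1`. -/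
instance : Zero (Witt K) := ⟨⟨1, by simp⟩⟩

/-- The Witt opposite is the multiplicative inverse of power series. -/
instance : Neg (Witt K) := ⟨fun α => ⟨α.series⁻¹, by
  simp [α.constantCoeff_series]⟩⟩

/-- The power series `(1 - a t)⁻¹`. -/
def geom (a : K) : Witt K := ⟨(1 - C a * X)⁻¹, by simp⟩

/-- The Witt unit is `(1 - t)⁻¹`. -/
instance : One (Witt K) := ⟨geom 1⟩

@[simp] theorem series_add (α β : Witt K) : (α + β).series = α.series * β.series := rfl
@[simp] theorem series_zero : (0 : Witt K).series = 1 := rfl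
@[simp] theorem series_neg (α : Witt K) : (-α).series = α.series⁻¹ := rfl

theorem series_ne_zero (α : Witt K) : constantCoeff α.series ≠ 0 := by
  simp [α.constantCoeff_series]

theorem ghost_add (α β : Witt K) : ghost (α + β) = ghost α + ghost β := by
  have h1 := PowerSeries.mul_inv_cancel _ α.series_ne_zero
  have h2 := PowerSeries.mul_inv_cancel _ β.series_ne_zero
  simp only [ghost, series_add, PowerSeries.mul_inv_rev, Derivation.leibniz, smul_eq_mul]
  linear_combination (X * d⁄dX K β.series * β.series⁻¹) * h1 +
    (X * d⁄dX K α.series * α.series⁻¹) * h2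

theorem ghost_zero : ghost (0 : Witt K) = 0 := by
  simp [ghost]

theorem ghost_neg (α : Witt K) : ghost (-α) = -ghost α := by
  have h : ghost (-α + α) = 0 := by
    rw [← ghost_zero]
    congr 1
    ext1
    simpa using PowerSeries.inv_mul_cancel _ α.series_ne_zero
  rw [ghost_add] at h
  exact eq_neg_of_add_eq_zero_left h

theorem constantCoeff_ghost (α : Witt K) : constantCoeff (ghost α) = 0 := by
  simp [ghost]

theorem coeff_ghost_geom (a : K) (n : ℕ) (hn : n ≠ 0) : coeff n (ghost (geom a)) = a ^ n := by
  have h0 : constantCoeff (1 - C a * X : K⟦X⟧) ≠ 0 := by simp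
  have h : ghost (geom a) = C a * X * (1 - C a * X : K⟦X⟧)⁻¹ := by
    have h1 := PowerSeries.mul_inv_cancel _ h0
    have h2 : ((1 - C a * X : K⟦X⟧)⁻¹)⁻¹ = 1 - C a * X := by
      rw [PowerSeries.inv_eq_iff_mul_eq_one (by simp)]
      exact h1
    simp only [ghost, geom, h2, derivative_inv']
    simp only [map_sub, Derivation.leibniz, derivative_C, derivative_X, smul_eq_mul,
      derivative_one]
    linear_combination (C a * X * (1 - C a * X : K⟦X⟧)⁻¹) * h1
  have hs : (1 - C a * X : K⟦X⟧)⁻¹ = PowerSeries.mk fun n => a ^ n := by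
    rw [PowerSeries.inv_eq_iff_mul_eq_one h0]
    ext m
    rcases m with _ | m
    · simp
    · rw [mul_sub, mul_one, ← mul_assoc, mul_comm _ (C a), mul_assoc]
      simp [pow_succ, mul_comm, coeff_one]
  obtain ⟨m, rfl⟩ := Nat.exists_eq_succ_of_ne_zero hn
  rw [h, hs, mul_assoc, mul_comm X]
  simp [pow_succ, mul_comm]

variable [CharZero K]

theorem constantCoeff_exp_subst (u : K⟦X⟧) (hu : constantCoeff u = 0) :
    constantCoeff ((PowerSeries.exp K).subst u) = 1 := by
  have hs : HasSubst u := HasSubst.of_constantCoeff_zero' hu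
  have h1 : (PowerSeries.exp K).subst u = 1 + (PowerSeries.exp K - 1).subst u := by
    rw [← coe_substAlgHom hs, map_sub, map_one]
    ring
  have h2 : constantCoeff ((PowerSeries.exp K - 1).subst u) = 0 :=
    constantCoeff_subst_eq_zero hu _ (by simp)
  rw [h1, map_add, h2]
  simp

/-- Elements of the Witt ring in exponential form: the series `exp (∑_{r ≥ 1} a_r t^r / r)`
attached to `f = ∑ a_r t^r`.  The term `r = 0` is `a_0 / 0 = 0`, so it does not contribute. -/
def ofGhost (f : K⟦X⟧) : Witt K :=
  ⟨(PowerSeries.exp K).subst (PowerSeries.mk fun r => coeff r f / (r : K) : K⟦X⟧), by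
    have h : constantCoeff (PowerSeries.mk fun r => coeff r f / (r : K) : K⟦X⟧) = 0 := by
      rw [← coeff_zero_eq_constantCoeff_apply, coeff_mk]; simp
    exact constantCoeff_exp_subst _ h⟩

theorem ghost_ofGhost (f : K⟦X⟧) (hf : constantCoeff f = 0) : ghost (ofGhost f) = f := by
  have h : constantCoeff (PowerSeries.mk fun r => coeff r f / (r : K) : K⟦X⟧) = 0 := by
    rw [← coeff_zero_eq_constantCoeff_apply, coeff_mk]; simp
  have hE := PowerSeries.mul_inv_cancel _ (ofGhost f).series_ne_zero
  have hd : d⁄dX K (ofGhost f).series = (ofGhost f).series *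
      d⁄dX K (PowerSeries.mk fun r => coeff r f / (r : K) : K⟦X⟧) := by
    change d⁄dX K ((PowerSeries.exp K).subst _) = _
    rw [derivative_subst (HasSubst.of_constantCoeff_zero' h), derivative_exp]
    rfl
  have hg : ghost (ofGhost f) =
      X * d⁄dX K (PowerSeries.mk fun r => coeff r f / (r : K) : K⟦X⟧) := by
    rw [ghost, hd]
    linear_combination
      (X * d⁄dX K (PowerSeries.mk fun r => coeff r f / (r : K) : K⟦X⟧)) * hE
  rw [hg]
  ext n
  rcases n with _ | n
  · simp [hf]
  · rw [coeff_succ_X_mul, coeff_derivative, coeff_mk]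
    have : ((n : K) + 1) ≠ 0 := by exact_mod_cast Nat.succ_ne_zero n
    push_cast
    field_simp

theorem ghost_injective : Function.Injective (ghost : Witt K → K⟦X⟧) := by
  intro α β h
  have hβ := PowerSeries.mul_inv_cancel _ β.series_ne_zero
  have h0 : ghost (α + -β) = 0 := by rw [ghost_add, ghost_neg, h, add_neg_cancel]
  have hγ := PowerSeries.mul_inv_cancel _ (α + -β).series_ne_zero
  have h1 : d⁄dX K (α + -β).series = 0 := by
    have hX : X * d⁄dX K (α + -β).series = 0 := by
      have h2 : ghost (α + -β) * (α + -β).series = 0 := by rw [h0, zero_mul]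
      rw [ghost] at h2
      linear_combination h2 - (X * d⁄dX K (α + -β).series) * hγ
    exact (mul_eq_zero.mp hX).resolve_left X_ne_zero
  have h3 : (α + -β).series = 1 := by
    apply derivative.ext
    · rw [h1, derivative_one]
    · rw [(α + -β).constantCoeff_series, map_one]
  rw [series_add, series_neg] at h3
  ext1
  linear_combination β.series * h3 - α.series * hβ

/-- The Witt product: the coordinatewise product of ghost coordinates. -/
instance : Mul (Witt K) :=
  ⟨fun α β => ofGhost (PowerSeries.mk fun n => coeff n (ghost α) * coeff n (ghost β))⟩

theorem coeff_ghost_mul (α β : Witt K) (n : ℕ) :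
    coeff n (ghost (α * β)) = coeff n (ghost α) * coeff n (ghost β) := by
  change coeff n (ghost (ofGhost _)) = _
  rw [ghost_ofGhost, coeff_mk]
  rw [← coeff_zero_eq_constantCoeff_apply, coeff_mk]
  simp [constantCoeff_ghost]

/-- The defining rule of the Witt product. -/
theorem geom_mul_geom (a b : K) : geom a * geom b = geom (a * b) := by
  apply ghost_injective
  ext n
  rcases eq_or_ne n 0 with rfl | hn
  · simp [constantCoeff_ghost]
  · rw [coeff_ghost_mul, coeff_ghost_geom _ _ hn, coeff_ghost_geom _ _ hn,
      coeff_ghost_geom _ _ hn, mul_pow]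

theorem ext_coeff_ghost {α β : Witt K}
    (h : ∀ n : ℕ, n ≠ 0 → coeff n (ghost α) = coeff n (ghost β)) : α = β := by
  apply ghost_injective
  ext n
  rcases eq_or_ne n 0 with rfl | hn
  · simp [constantCoeff_ghost]
  · exact h n hn

instance : CommRing (Witt K) where
  add_assoc a b c := by ext1; simp [mul_assoc]
  zero_add a := by ext1; simp
  add_zero a := by ext1; simp
  add_comm a b := by ext1; simp [mul_comm]
  neg_add_cancel a := by
    ext1
    simpa using PowerSeries.inv_mul_cancel _ a.series_ne_zero
  nsmul := nsmulRec
  zsmul := zsmulRec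
  mul_assoc a b c := ext_coeff_ghost fun n _ => by simp only [coeff_ghost_mul, mul_assoc]
  mul_comm a b := ext_coeff_ghost fun n _ => by simp only [coeff_ghost_mul, mul_comm]
  one_mul a := ext_coeff_ghost fun n hn => by
    rw [coeff_ghost_mul]
    change coeff n (ghost (geom 1)) * _ = _
    rw [coeff_ghost_geom _ _ hn, one_pow, one_mul]
  mul_one a := ext_coeff_ghost fun n hn => by
    rw [coeff_ghost_mul]
    change _ * coeff n (ghost (geom 1)) = _
    rw [coeff_ghost_geom _ _ hn, one_pow, mul_one]
  left_distrib a b c := ext_coeff_ghost fun n _ => by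
    simp only [coeff_ghost_mul, ghost_add, map_add, mul_add]
  right_distrib a b c := ext_coeff_ghost fun n _ => by
    simp only [coeff_ghost_mul, ghost_add, map_add, add_mul]
  zero_mul a := ext_coeff_ghost fun n _ => by simp [coeff_ghost_mul, ghost_zero]
  mul_zero a := ext_coeff_ghost fun n _ => by simp [coeff_ghost_mul, ghost_zero]

/-- The convolution product on `W(K)`, induced by the product of the ghost series:
`exp (∑_{n ≥ 1} (∑_{r + l = n} α_r γ_l) t^n / n)`. -/
def conv (α γ : Witt K) : Witt K := ofGhost (ghost α * ghost γ)

end Witt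

/-! ### Rota--Baxter operators and the `q`-integral -/

/-- `T` is an additive operator on `A` satisfying the Rota--Baxter identity of weight `lam`
with respect to the product `mul`. -/
structure IsRotaBaxter {A : Type*} [AddCommGroup A] (mul : A → A → A) (lam : ℤ)
    (T : A → A) : Prop where
  map_add : ∀ a b, T (a + b) = T a + T b
  identity : ∀ a b, mul (T a) (T b) = T (mul a (T b)) + T (mul (T a) b) + lam • T (mul a b)

/-- The `c`-integral `α(t) ↦ ∑_{k ≥ 1} α(c^k t)` on `t K[[t]]`, for `c` not a root of unity: the
linear operator with `t^n ↦ c^n / (1 - c^n) t^n` for `n ≥ 1` (and the value `0` on constants, which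
do not occur among ghost series).  See `hasSum_qIntegral` for the sum. -/
def qIntegral {K : Type v} [Field K] (c : K) (f : K⟦X⟧) : K⟦X⟧ :=
  PowerSeries.mk fun n => c ^ n / (1 - c ^ n) * coeff n f

theorem hasSum_qIntegral {K : Type v} [NormedField K] (c : K) (hc : ‖c‖ < 1) (f : K⟦X⟧)
    (hf : constantCoeff f = 0) :
    HasSum (fun m : ℕ+ => rescale (c ^ (m : ℕ)) f) (qIntegral c f) := by
  rw [PowerSeries.WithPiTopology.hasSum_iff_hasSum_coeff]
  intro n
  rcases eq_or_ne n 0 with rfl | hn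
  · simp [qIntegral, hf]
  · simp only [qIntegral, coeff_mk, coeff_rescale]
    apply HasSum.mul_right
    rw [← Equiv.pnatEquivNat.symm.hasSum_iff]
    have hc' : ‖c ^ n‖ < 1 := by
      rw [norm_pow]
      exact pow_lt_one₀ (norm_nonneg _) hc hn
    have h := (hasSum_geometric_of_norm_lt_one hc').mul_left (c ^ n)
    rw [← div_eq_mul_inv] at h
    convert h using 2 with m
    simp [← pow_mul, ← pow_add]
    ring

/-- The operator `𝒯_{W,c}` on `W(K)`, determined by `g(𝒯_{W,c}(α)) = 𝒯_c(g(α))`. -/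
def wittQIntegral {K : Type v} [Field K] [CharZero K] (c : K) (α : Witt K) : Witt K :=
  Witt.ofGhost (qIntegral c α.ghost)

theorem ghost_wittQIntegral {K : Type v} [Field K] [CharZero K] (c : K) (α : Witt K) :
    (wittQIntegral c α).ghost = qIntegral c α.ghost := by
  apply Witt.ghost_ofGhost
  rw [← coeff_zero_eq_constantCoeff_apply, qIntegral, coeff_mk]
  simp

/-! ### Schemes of finite type and the Grothendieck ring -/

/-- A scheme of finite type over the field `k`. -/
structure FTScheme (k : Type u) [Field k] where
  /-- the scheme, with its structure morphism to `Spec k` -/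
  obj : Over (Spec (CommRingCat.of k))
  locallyOfFiniteType : LocallyOfFiniteType obj.hom
  quasiCompact : QuasiCompact obj.hom

/-- An affine `k`-scheme `Spec A`, as a scheme over `k`. -/
abbrev specOver (k A : Type u) [Field k] [CommRing A] [Algebra k A] :
    Over (Spec (CommRingCat.of k)) :=
  Over.mk (Spec.map (CommRingCat.ofHom (algebraMap k A)))

/-- The affine line `Spec k[x]` over `k`. -/
def affineLine (k : Type u) [Field k] : FTScheme k where
  obj := specOver k (Polynomial k)
  locallyOfFiniteType := by
    dsimp
    rw [HasRingHomProperty.Spec_iff (P := @LocallyOfFiniteType)]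
    change (algebraMap k (Polynomial k)).FiniteType
    rw [RingHom.finiteType_algebraMap]
    infer_instance
  quasiCompact := by
    dsimp; infer_instance

/-- The point `Spec k`. -/
def point (k : Type u) [Field k] : FTScheme k where
  obj := Over.mk (𝟙 _)
  locallyOfFiniteType := by dsimp; infer_instance
  quasiCompact := by dsimp; infer_instance

/-- The relations of the Grothendieck ring, on the free commutative ring on all schemes of finite
type over `k`: isomorphism invariance, `[X] = [Z] + [X ∖ Z]` for a closed subscheme `Z` of `X`,
`[X × Y] = [X] [Y]`, and `[Spec k] = 1`. -/
inductive K0Rel (k : Type u) [Field k] :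
    FreeCommRing (FTScheme k) → FreeCommRing (FTScheme k) → Prop
  | iso (X Y : FTScheme k) (e : X.obj ≅ Y.obj) :
      K0Rel k (FreeCommRing.of X) (FreeCommRing.of Y)
  | scissor (X Z U : FTScheme k) (i : Z.obj ⟶ X.obj) (j : U.obj ⟶ X.obj)
      (hi : IsClosedImmersion i.left) (hj : IsOpenImmersion j.left)
      (h : Set.range j.left = (Set.range i.left)ᶜ) :
      K0Rel k (FreeCommRing.of X) (FreeCommRing.of Z + FreeCommRing.of U)
  | prod (X Y P : FTScheme k) (p : P.obj ⟶ X.obj) (p' : P.obj ⟶ Y.obj)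
      (h : IsPullback p.left p'.left X.obj.hom Y.obj.hom) :
      K0Rel k (FreeCommRing.of P) (FreeCommRing.of X * FreeCommRing.of Y)
  | one : K0Rel k (FreeCommRing.of (point k)) 1

/-- The Grothendieck ring of schemes of finite type over `k`. -/
abbrev K0 (k : Type u) [Field k] : Type (u + 1) := RingQuot (K0Rel k)

/-- The Lefschetz motive `𝕃 = [𝔸¹]`. -/
def lefschetz (k : Type u) [Field k] : K0 k :=
  RingQuot.mkRingHom (K0Rel k) (FreeCommRing.of (affineLine k))

/-- The localized Grothendieck ring `K₀[𝕃⁻¹]`. -/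
abbrev K0Loc (k : Type u) [Field k] : Type (u + 1) := Localization.Away (lefschetz k)

/-- The class `[X]` in `K₀[𝕃⁻¹]`. -/
def cls {k : Type u} [Field k] (X : FTScheme k) : K0Loc k :=
  algebraMap (K0 k) (K0Loc k) (RingQuot.mkRingHom (K0Rel k) (FreeCommRing.of X))

/-- The Lefschetz motive `𝕃` in `K₀[𝕃⁻¹]`. -/
def lef (k : Type u) [Field k] : K0Loc k := cls (affineLine k)

/-- The Tate motive `𝕃⁻¹` in `K₀[𝕃⁻¹]`. -/
def tate (k : Type u) [Field k] : K0Loc k := IsLocalization.Away.invSelf (lefschetz k)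

theorem lef_mul_tate (k : Type u) [Field k] : lef k * tate k = 1 :=
  IsLocalization.Away.mul_invSelf (lefschetz k)

/-! ### Hasse--Weil zeta functions -/

/-- The extension `𝔽_{q^r}` of the finite field `k = 𝔽_q`: the splitting field of
`x^(q^r) - x` over `k`. -/
abbrev fieldExt (k : Type u) [Field k] (r : ℕ) : Type u :=
  (Polynomial.X ^ (Nat.card k ^ r) - Polynomial.X : Polynomial k).SplittingField

/-- The number `# X(𝔽_{q^r})` of `k`-morphisms `Spec 𝔽_{q^r} ⟶ X`. -/
def numPoints {k : Type u} [Field k] (X : FTScheme k) (r : ℕ) : ℕ :=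
  Nat.card (specOver k (fieldExt k r) ⟶ X.obj)

/-- The Hasse--Weil zeta function `Z(X,t) = exp (∑_{r ≥ 1} # X(𝔽_{q^r}) t^r / r)`, as an element
of the Witt ring of `K`. -/
def zeta {k : Type u} [Field k] (K : Type v) [Field K] [CharZero K] (X : FTScheme k) : Witt K :=
  Witt.ofGhost (PowerSeries.mk fun r => if r = 0 then 0 else (numPoints X r : K))

end

end WittZeta

open WittZeta

/-!
Everything is checked on ghost coordinates, which determine an element of `W(K)` because `K` has
characteristic zero.

On ghost series the operator `𝒯_{W,c}` multiplies the coefficient of `t ^ n` by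
`c ^ n / (1 - c ^ n)`, and the convolution is the product of power series, so the Rota--Baxter
identity reduces to a rational identity in `c ^ i` and `c ^ j` (`qIntegral_mul_qIntegral`). It needs
only that no power `c ^ n` with `n ≥ 1` equals `1`.

The ghost coordinates of `Z(X, t)` are the numbers of points of `X` over finite extensions `F` of
`k`, so the relations of `K₀` translate into statements on points. A morphism `Spec F ⟶ X` has a
one-point image, which lies either in a closed subscheme `Z` or in its complement, and it lifts
accordingly, in the closed case because `Spec F` is reduced (`card_points_scissor`); products are
handled by their universal property. The sets of points are finite (`finite_points`), which the
additivity of `Nat.card` requires. As `𝔸¹` has `q ^ r` points over `𝔽_{q ^ r}`, the image of `𝕃` is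
`(1 - q t)⁻¹`, a unit of `W(K)`, and the homomorphism extends to `K₀[𝕃⁻¹]`
(`existsUnique_zetaHom`).

Finally, multiplying by `(1 - a t)⁻¹` in `W(K)` rescales the ghost series by `t ↦ a t`, so the ghost
series of the factors `Z([X] 𝕃 ^ m, t)` are the summands `g(q ^ m t)` of the `q`-integral of
`g = g(Z(X, t))`, and likewise for `𝕃⁻¹`. The sum converges for `‖c‖ < 1` (`hasSum_qIntegral`),
and a convergent sum of ghost series gives a convergent product of power series, since each
coefficient of `α` depends polynomially on its ghost coordinates
(`hasProd_series_of_hasSum_ghost`).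
-/

namespace WittZeta

/-! ### Ghost coordinates, the convolution product and the `c`-integral -/

section Witt

variable {K : Type v} [Field K]

@[simp]
theorem coeff_qIntegral (c : K) (f : K⟦X⟧) (n : ℕ) :
    coeff n (qIntegral c f) = c ^ n / (1 - c ^ n) * coeff n f := by
  simp [qIntegral]

/-- Comparing coefficients, the Rota--Baxter identity for the `c`-integral amounts to
`u / (1 - u) * (v / (1 - v)) = uv / (1 - uv) * (v / (1 - v) + u / (1 - u) + 1)` with `u = c ^ i`,
`v = c ^ j`.  The terms with `i = 0` or `j = 0` vanish because `f` and `g` have no constant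
term. -/
theorem qIntegral_mul_qIntegral (c : K) (hc : ∀ n : ℕ, n ≠ 0 → c ^ n ≠ 1) (f g : K⟦X⟧)
    (hf : constantCoeff f = 0) (hg : constantCoeff g = 0) :
    qIntegral c f * qIntegral c g =
      qIntegral c (f * qIntegral c g) + qIntegral c (qIntegral c f * g) +
        qIntegral c (f * g) := by
  ext n
  simp only [map_add, coeff_qIntegral, coeff_mul, Finset.mul_sum, ← Finset.sum_add_distrib]
  refine Finset.sum_congr rfl fun p hp => ?_
  rw [Finset.HasAntidiagonal.mem_antidiagonal] at hp
  obtain ⟨i, j⟩ := p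
  dsimp only at hp ⊢
  subst hp
  rcases eq_or_ne i 0 with rfl | hi
  · simp [hf]
  rcases eq_or_ne j 0 with rfl | hj
  · simp [hg]
  have h1 : 1 - c ^ i ≠ 0 := sub_ne_zero.2 (hc i hi).symm
  have h2 : 1 - c ^ j ≠ 0 := sub_ne_zero.2 (hc j hj).symm
  have h3 : 1 - c ^ i * c ^ j ≠ 0 := by
    rw [← pow_add]; exact sub_ne_zero.2 (hc (i + j) (by omega)).symm
  rw [pow_add]
  field_simp
  ring

variable [CharZero K]

theorem ghost_conv (α γ : Witt K) : (Witt.conv α γ).ghost = α.ghost * γ.ghost := by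
  apply Witt.ghost_ofGhost
  simp [Witt.constantCoeff_ghost]

theorem isRotaBaxter_wittQIntegral (c : K) (hc : ∀ n : ℕ, n ≠ 0 → c ^ n ≠ 1) :
    IsRotaBaxter Witt.conv 1 (wittQIntegral c) where
  map_add a b := by
    apply Witt.ghost_injective
    simp only [ghost_wittQIntegral, Witt.ghost_add]
    ext n
    simp [mul_add]
  identity a b := by
    apply Witt.ghost_injective
    simp only [one_smul, ghost_wittQIntegral, Witt.ghost_add, ghost_conv]
    exact qIntegral_mul_qIntegral c hc _ _ (Witt.constantCoeff_ghost a)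
      (Witt.constantCoeff_ghost b)

theorem natCast_pow_ne_one {q : ℕ} (hq : 1 < q) (n : ℕ) (hn : n ≠ 0) : (q : K) ^ n ≠ 1 := by
  exact_mod_cast (Nat.one_lt_pow hn hq).ne'

theorem geom_pow (a : K) (m : ℕ) : Witt.geom a ^ m = Witt.geom (a ^ m) := by
  induction m with
  | zero => rw [pow_zero, pow_zero]; rfl
  | succ m ih => rw [pow_succ, ih, Witt.geom_mul_geom, pow_succ]

/-- Since `(1 - a t)⁻¹` has ghost coordinates `a ^ n`, the Witt product with it is `t ↦ a t`. -/
theorem ghost_mul_geom (α : Witt K) (a : K) :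
    (α * Witt.geom a).ghost = rescale a α.ghost := by
  ext n
  rcases eq_or_ne n 0 with rfl | hn
  · simp [Witt.constantCoeff_ghost]
  · rw [Witt.coeff_ghost_mul, Witt.coeff_ghost_geom _ _ hn, coeff_rescale, mul_comm]

theorem isUnit_geom {a : K} (ha : a ≠ 0) : IsUnit (Witt.geom a) :=
  IsUnit.of_mul_eq_one (Witt.geom a⁻¹) <| by
    rw [Witt.geom_mul_geom, mul_inv_cancel₀ ha]; rfl

theorem ghost_sum {ι : Type*} (s : Finset ι) (α : ι → Witt K) :
    (∑ i ∈ s, α i).ghost = ∑ i ∈ s, (α i).ghost :=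
  map_sum (⟨⟨Witt.ghost, Witt.ghost_zero⟩, Witt.ghost_add⟩ : Witt K →+ K⟦X⟧) α s

theorem series_sum {ι : Type*} (s : Finset ι) (α : ι → Witt K) :
    (∑ i ∈ s, α i).series = ∏ i ∈ s, (α i).series := by
  classical
  induction s using Finset.induction_on with
  | empty => simp
  | insert i s hi ih => rw [Finset.sum_insert hi, Finset.prod_insert hi, Witt.series_add, ih]

/-- The identity `t α' = g(α) α`, read off in degree `n + 1`: it expresses the coefficients of `α`
recursively through its ghost coordinates. -/
theorem coeff_succ_series (α : Witt K) (n : ℕ) :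
    coeff (n + 1) α.series = ((n : K) + 1)⁻¹ *
      ∑ i ∈ Finset.range (n + 1), coeff (n + 1 - i) α.ghost * coeff i α.series := by
  have h : α.series * α.ghost = X * d⁄dX K α.series := by
    have h1 := PowerSeries.mul_inv_cancel _ α.series_ne_zero
    rw [Witt.ghost]
    linear_combination (X * d⁄dX K α.series) * h1
  have h2 := congrArg (coeff (n + 1)) h
  rw [coeff_succ_X_mul, coeff_derivative, coeff_mul,
    Finset.Nat.sum_antidiagonal_eq_sum_range_succ_mk, Finset.sum_range_succ] at h2
  have h3 : ((n : K) + 1) ≠ 0 := by exact_mod_cast Nat.succ_ne_zero n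
  rw [eq_inv_mul_iff_mul_eq₀ h3, mul_comm, ← h2]
  simp [Witt.constantCoeff_ghost, mul_comm]

end Witt

/-! ### Convergence of infinite products -/

section Convergence

variable {K : Type v} [NormedField K] [CharZero K]

/-- Coefficientwise convergence of the ghost series implies coefficientwise convergence of the
series themselves: each coefficient of `α` is a polynomial in its ghost coordinates. -/
theorem tendsto_series_of_tendsto_ghost {ι : Type*} {l : Filter ι} {α : ι → Witt K} {β : Witt K}
    (h : Filter.Tendsto (fun i => (α i).ghost) l (nhds β.ghost)) :
    Filter.Tendsto (fun i => (α i).series) l (nhds β.series) := by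
  rw [PowerSeries.WithPiTopology.tendsto_iff_coeff_tendsto] at h ⊢
  intro n
  induction n using Nat.strong_induction_on with
  | _ n ih =>
    rcases n with _ | n
    · simp only [coeff_zero_eq_constantCoeff_apply, Witt.constantCoeff_series]
      exact tendsto_const_nhds
    · simp only [coeff_succ_series]
      refine Filter.Tendsto.const_mul _ (tendsto_finsetSum _ fun i hi => ?_)
      exact (h _).mul (ih i (Finset.mem_range.1 hi))

theorem hasProd_series_of_hasSum_ghost {ι : Type*} {α : ι → Witt K} {β : Witt K}
    (h : HasSum (fun i => (α i).ghost) β.ghost) :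
    HasProd (fun i => (α i).series) β.series := by
  unfold HasSum at h
  unfold HasProd
  simp only [← ghost_sum] at h
  simp only [← series_sum]
  exact tendsto_series_of_tendsto_ghost h

theorem hasProd_wittQIntegral {c : K} (hc : ‖c‖ < 1) (α : Witt K) :
    HasProd (fun m : ℕ+ => (α * Witt.geom c ^ (m : ℕ)).series) (wittQIntegral c α).series := by
  apply hasProd_series_of_hasSum_ghost
  simp only [geom_pow, ghost_mul_geom, ghost_wittQIntegral]
  exact hasSum_qIntegral c hc _ (Witt.constantCoeff_ghost α)

end Convergence

end WittZeta

namespace WittZeta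

/-! ### Rational points -/

section Points

variable {k : Type u} [Field k]

/-- Morphisms of affine `k`-schemes are homomorphisms of `k`-algebras. -/
noncomputable def specOverHomEquiv (A B : Type u) [CommRing A] [Algebra k A] [CommRing B]
    [Algebra k B] : (specOver k B ⟶ specOver k A) ≃ (A →ₐ[k] B) where
  toFun f :=
    { (Spec.preimage f.left).hom with
      commutes' := fun r => by
        have h : CommRingCat.ofHom (algebraMap k A) ≫ Spec.preimage f.left =
            CommRingCat.ofHom (algebraMap k B) := by
          apply Spec.map_injective
          rw [Spec.map_comp, Spec.map_preimage]
          exact Over.w f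
        exact congrArg (fun φ => φ.hom r) h }
  invFun φ := Over.homMk (Spec.map (CommRingCat.ofHom φ.toRingHom)) (by
    dsimp
    rw [← Spec.map_comp, ← CommRingCat.ofHom_comp]
    congr 2
    exact φ.comp_algebraMap)
  left_inv f := by
    ext1
    exact Spec.map_preimage f.left
  right_inv φ := by
    ext x
    exact congrArg (fun ψ => ψ.hom x) (Spec.preimage_map (CommRingCat.ofHom φ.toRingHom))

/-- A homomorphism is determined by its values on a finite set of generators. -/
theorem finite_algHom_of_finiteType (A B : Type*) [CommRing A] [Algebra k A] [CommRing B]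
    [Algebra k B] [Algebra.FiniteType k A] [Finite B] : Finite (A →ₐ[k] B) := by
  obtain ⟨s, hs⟩ := Algebra.FiniteType.out (R := k) (A := A)
  refine Finite.of_injective (fun (φ : A →ₐ[k] B) (x : s) => φ x) fun φ ψ h => ?_
  exact AlgHom.ext_of_adjoin_eq_top hs fun x hx => congrFun h ⟨x, hx⟩

/-- A `k`-point of `Spec R` is a homomorphism out of an algebra of finite type. -/
theorem finite_hom_over_Spec (F : Type u) [Field F] [Algebra k F] [Finite F] (R : CommRingCat.{u})
    (g : Spec R ⟶ Spec (CommRingCat.of k)) [LocallyOfFiniteType g] :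
    Finite (specOver k F ⟶ Over.mk g) := by
  obtain ⟨ψ, rfl⟩ : ∃ ψ, g = Spec.map ψ := ⟨_, (Spec.map_preimage g).symm⟩
  have hψ : ψ.hom.FiniteType := (HasRingHomProperty.Spec_iff (P := @LocallyOfFiniteType)).1 ‹_›
  algebraize [ψ.hom]
  have := finite_algHom_of_finiteType (k := k) R F
  exact Finite.of_equiv _ (specOverHomEquiv (k := k) (R : Type u) F).symm

/-- A point of a quasi-compact scheme factors through one of finitely many affine open
subschemes. -/
theorem finite_points (F : Type u) [Field F] [Algebra k F] [Finite F] (X : FTScheme k) :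
    Finite (specOver k F ⟶ X.obj) := by
  have := X.locallyOfFiniteType
  have := X.quasiCompact
  have : CompactSpace X.obj.left := (quasiCompact_iff_compactSpace X.obj.hom).1 this
  let 𝒰 := X.obj.left.affineCover.finiteSubcover
  have h (i : 𝒰.I₀) : Finite (specOver k F ⟶ Over.mk (𝒰.f i ≫ X.obj.hom)) :=
    have : LocallyOfFiniteType (𝒰.f i ≫ X.obj.hom) :=
      locallyOfFiniteType_comp (𝒰.f i) X.obj.hom
    @finite_hom_over_Spec k _ F _ _ _ _ (𝒰.f i ≫ X.obj.hom) this
  refine Finite.of_surjective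
    (fun p : Σ i : 𝒰.I₀, specOver k F ⟶ Over.mk (𝒰.f i ≫ X.obj.hom) =>
      p.2 ≫ Over.homMk (V := X.obj) (𝒰.f p.1)) fun f => ?_
  let x : Spec (CommRingCat.of F) := IsLocalRing.closedPoint F
  obtain ⟨y, hy⟩ := 𝒰.covers (f.left x)
  have hr : Set.range f.left ⊆ Set.range (𝒰.f (𝒰.idx (f.left x))) := by
    rintro _ ⟨z, rfl⟩
    exact ⟨y, by rw [hy, Subsingleton.elim (α := Spec (CommRingCat.of F)) z x]⟩
  refine ⟨⟨_, Over.homMk (IsOpenImmersion.lift _ f.left hr) ?_⟩, ?_⟩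
  · dsimp
    rw [IsOpenImmersion.lift_fac_assoc]
    exact Over.w f
  · ext1
    exact IsOpenImmersion.lift_fac _ _ _

/-- A morphism from a reduced scheme whose image lies in a closed subscheme factors through it:
the base change of the closed immersion is a surjective closed immersion onto a reduced scheme,
hence an isomorphism. -/
theorem exists_lift_of_isClosedImmersion {T X Z : Scheme.{u}} [IsReduced T] (i : Z ⟶ X)
    [IsClosedImmersion i] (f : T ⟶ X) (h : Set.range f ⊆ Set.range i) :
    ∃ g : T ⟶ Z, g ≫ i = f := by
  have hs : Surjective (Limits.pullback.fst f i) := by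
    refine ⟨Set.range_eq_univ.1 ?_⟩
    rw [Scheme.Pullback.range_fst]
    exact Set.eq_univ_of_forall fun t => h ⟨t, rfl⟩
  have := isIso_of_isClosedImmersion_of_surjective (Limits.pullback.fst f i)
  refine ⟨inv (Limits.pullback.fst f i) ≫ Limits.pullback.snd f i, ?_⟩
  rw [Category.assoc, ← Limits.pullback.condition, IsIso.inv_hom_id_assoc]

/-- A point of `X` lies either in the closed subscheme `Z` or in its open complement `U`. -/
theorem card_points_scissor (F : Type u) [Field F] [Algebra k F] [Finite F] (X Z U : FTScheme k)
    (i : Z.obj ⟶ X.obj) (j : U.obj ⟶ X.obj) (hi : IsClosedImmersion i.left)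
    (hj : IsOpenImmersion j.left) (h : Set.range j.left = (Set.range i.left)ᶜ) :
    Nat.card (specOver k F ⟶ X.obj) =
      Nat.card (specOver k F ⟶ Z.obj) + Nat.card (specOver k F ⟶ U.obj) := by
  have := finite_points F Z
  have := finite_points F U
  let x : Spec (CommRingCat.of F) := IsLocalRing.closedPoint F
  rw [← Nat.card_sum]
  symm
  refine Nat.card_congr (Equiv.ofBijective
    (Sum.elim (fun f : specOver k F ⟶ Z.obj => f ≫ i) (fun f : specOver k F ⟶ U.obj => f ≫ j))
    ⟨?_, fun f => ?_⟩)
  · have hne (f : specOver k F ⟶ Z.obj) (g : specOver k F ⟶ U.obj) : f ≫ i ≠ g ≫ j := by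
      intro e
      have e' : i.left (f.left x) = j.left (g.left x) :=
        congrArg (fun φ : specOver k F ⟶ X.obj => φ.left x) e
      exact (h.le ⟨_, rfl⟩ : j.left (g.left x) ∉ Set.range i.left) ⟨_, e'⟩
    refine Function.Injective.sumElim (fun f g e => ?_) (fun f g e => ?_) hne
    · ext1
      rw [← cancel_mono i.left]
      exact congrArg (fun φ => φ.left) e
    · ext1
      rw [← cancel_mono j.left]
      exact congrArg (fun φ => φ.left) e
  · have hr : Set.range f.left = {f.left x} := by
      ext y
      constructor
      · rintro ⟨z, rfl⟩
        rw [Subsingleton.elim (α := Spec (CommRingCat.of F)) z x]; rfl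
      · rintro rfl
        exact ⟨x, rfl⟩
    by_cases hx : f.left x ∈ Set.range i.left
    · have : IsReduced (specOver k F).left :=
        inferInstanceAs (IsReduced (Spec (CommRingCat.of F)))
      obtain ⟨g, hg⟩ := exists_lift_of_isClosedImmersion i.left f.left (by simpa [hr] using hx)
      refine ⟨Sum.inl (Over.homMk g ?_), ?_⟩
      · rw [← Over.w i, ← Category.assoc, hg, Over.w f]
      · ext1
        exact hg
    · have hx' : Set.range f.left ⊆ Set.range j.left := by
        rw [hr, h]; simpa using hx
      refine ⟨Sum.inr (Over.homMk (IsOpenImmersion.lift j.left f.left hx') ?_), ?_⟩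
      · rw [← Over.w j, IsOpenImmersion.lift_fac_assoc, Over.w f]
      · ext1
        exact IsOpenImmersion.lift_fac _ _ _

/-- The universal property of the fibre product over `Spec k`. -/
theorem card_points_prod (T : Over (Spec (CommRingCat.of k))) (X Y P : FTScheme k)
    (p : P.obj ⟶ X.obj) (p' : P.obj ⟶ Y.obj)
    (h : IsPullback p.left p'.left X.obj.hom Y.obj.hom) :
    Nat.card (T ⟶ P.obj) = Nat.card (T ⟶ X.obj) * Nat.card (T ⟶ Y.obj) := by
  rw [← Nat.card_prod]
  refine Nat.card_congr (Equiv.ofBijective (fun f => (f ≫ p, f ≫ p')) ⟨fun f g e => ?_, ?_⟩)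
  · obtain ⟨e1, e2⟩ := Prod.mk.inj e
    ext1
    exact h.hom_ext (congrArg (fun φ => φ.left) e1) (congrArg (fun φ => φ.left) e2)
  · rintro ⟨f, g⟩
    refine ⟨Over.homMk (h.lift f.left g.left (by rw [Over.w, Over.w])) ?_, ?_⟩
    · rw [← Over.w p, h.lift_fst_assoc, Over.w]
    · refine Prod.ext ?_ ?_
      · ext1
        exact h.lift_fst _ _ _
      · ext1
        exact h.lift_snd _ _ _

theorem card_points_point (T : Over (Spec (CommRingCat.of k))) :
    Nat.card (T ⟶ (point k).obj) = 1 := by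
  have : Subsingleton (T ⟶ (point k).obj) := ⟨Over.mkIdTerminal.hom_ext⟩
  have : Nonempty (T ⟶ (point k).obj) := ⟨Over.mkIdTerminal.from T⟩
  exact Nat.card_unique

/-- The points of the affine line over `F` are the elements of `F`. -/
theorem card_points_affineLine (F : Type u) [Field F] [Algebra k F] :
    Nat.card (specOver k F ⟶ (affineLine k).obj) = Nat.card F :=
  Nat.card_congr ((specOverHomEquiv (Polynomial k) F).trans (Polynomial.aevalEquiv k F).symm)

variable [Finite k]

/-- The splitting field of `x ^ (q ^ r) - x` over `k` has `q ^ r` elements; for `r = 0` the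
polynomial is zero and the splitting field is `k` itself. -/
theorem card_fieldExt {r : ℕ} (hr : r ≠ 0) : Nat.card (fieldExt k r) = Nat.card k ^ r := by
  obtain ⟨p, hp⟩ := CharP.exists k
  have : Fact p.Prime := ⟨CharP.char_is_prime k p⟩
  have : NeZero r := ⟨hr⟩
  rw [← FiniteField.natCard_extension k p r]
  exact Nat.card_congr (Polynomial.IsSplittingField.algEquiv (FiniteField.Extension k p r)
    (Polynomial.X ^ Nat.card k ^ r - Polynomial.X)).symm.toEquiv

theorem finite_fieldExt {r : ℕ} (hr : r ≠ 0) : Finite (fieldExt k r) :=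
  Nat.finite_of_card_ne_zero (by rw [card_fieldExt hr]; exact pow_ne_zero _ Nat.card_pos.ne')

end Points

end WittZeta

namespace WittZeta

/-! ### The zeta function as a motivic measure -/

section Zeta

variable {k : Type u} [Field k] {K : Type v} [Field K] [CharZero K]

theorem coeff_ghost_zeta (X : FTScheme k) {r : ℕ} (hr : r ≠ 0) :
    coeff r (zeta K X).ghost = numPoints X r := by
  rw [zeta, Witt.ghost_ofGhost, coeff_mk, if_neg hr]
  rw [← coeff_zero_eq_constantCoeff_apply, coeff_mk, if_pos rfl]

theorem zeta_point : zeta K (point k) = 1 := by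
  refine Witt.ext_coeff_ghost fun r hr => ?_
  change _ = coeff r (Witt.geom 1).ghost
  rw [coeff_ghost_zeta _ hr, numPoints, card_points_point, Witt.coeff_ghost_geom _ _ hr]
  simp

variable [Finite k]

/-- The zeta function of the affine line is `(1 - q t)⁻¹`. -/
theorem zeta_affineLine : zeta K (affineLine k) = Witt.geom (Nat.card k : K) := by
  refine Witt.ext_coeff_ghost fun r hr => ?_
  rw [coeff_ghost_zeta _ hr, numPoints, card_points_affineLine, Witt.coeff_ghost_geom _ _ hr,
    card_fieldExt hr, Nat.cast_pow]

theorem lift_zeta_eq_of_rel {a b : FreeCommRing (FTScheme k)} (h : K0Rel k a b) :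
    FreeCommRing.lift (zeta K) a = FreeCommRing.lift (zeta K) b := by
  induction h with
  | iso X Y e =>
    simp only [FreeCommRing.lift_of]
    refine Witt.ext_coeff_ghost fun r hr => ?_
    rw [coeff_ghost_zeta _ hr, coeff_ghost_zeta _ hr, numPoints, numPoints,
      Nat.card_congr e.homToEquiv]
  | scissor X Z U i j hi hj h =>
    simp only [FreeCommRing.lift_of, map_add]
    refine Witt.ext_coeff_ghost fun r hr => ?_
    have := finite_fieldExt (k := k) hr
    rw [Witt.ghost_add, map_add, coeff_ghost_zeta _ hr, coeff_ghost_zeta _ hr,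
      coeff_ghost_zeta _ hr, numPoints, card_points_scissor _ X Z U i j hi hj h, Nat.cast_add]
    rfl
  | prod X Y P p p' h =>
    simp only [FreeCommRing.lift_of, map_mul]
    refine Witt.ext_coeff_ghost fun r hr => ?_
    rw [Witt.coeff_ghost_mul, coeff_ghost_zeta _ hr, coeff_ghost_zeta _ hr,
      coeff_ghost_zeta _ hr, numPoints, card_points_prod _ X Y P p p' h, Nat.cast_mul]
    rfl
  | one => rw [FreeCommRing.lift_of, map_one, zeta_point]

variable (k K)

/-- The motivic measure `K₀ → W(K)` with `[X] ↦ Z(X, t)`. -/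
noncomputable def zetaK0 : K0 k →+* Witt K :=
  RingQuot.lift ⟨FreeCommRing.lift (zeta K), fun _ _ h => lift_zeta_eq_of_rel h⟩

theorem zetaK0_of (X : FTScheme k) :
    zetaK0 k K (RingQuot.mkRingHom (K0Rel k) (FreeCommRing.of X)) = zeta K X := by
  rw [zetaK0, RingQuot.lift_mkRingHom_apply, FreeCommRing.lift_of]

theorem isUnit_zetaK0_lefschetz : IsUnit (zetaK0 k K (lefschetz k)) := by
  rw [lefschetz, zetaK0_of, zeta_affineLine]
  exact isUnit_geom (Nat.cast_ne_zero.2 Nat.card_pos.ne')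

theorem existsUnique_zetaHom :
    ∃! ζ : K0Loc k →+* Witt K, ∀ X : FTScheme k, ζ (cls X) = zeta K X := by
  refine ⟨IsLocalization.Away.lift (lefschetz k) (isUnit_zetaK0_lefschetz k K), fun X => ?_,
    fun ζ hζ => ?_⟩
  · rw [cls, IsLocalization.Away.lift_eq, zetaK0_of]
  · refine IsLocalization.ringHom_ext (Submonoid.powers (lefschetz k)) ?_
    rw [IsLocalization.Away.lift_comp]
    refine RingQuot.ringQuot_ext _ _ (FreeCommRing.hom_ext fun X => ?_)
    exact (hζ X).trans (zetaK0_of k K X).symm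

variable {k K}

theorem zetaHom_lef {ζ : K0Loc k →+* Witt K} (hζ : ∀ X : FTScheme k, ζ (cls X) = zeta K X) :
    ζ (lef k) = Witt.geom (Nat.card k : K) := by
  rw [lef, hζ, zeta_affineLine]

theorem zetaHom_tate {ζ : K0Loc k →+* Witt K} (hζ : ∀ X : FTScheme k, ζ (cls X) = zeta K X) :
    ζ (tate k) = Witt.geom (Nat.card k : K)⁻¹ := by
  have hq : (Nat.card k : K) ≠ 0 := Nat.cast_ne_zero.2 Nat.card_pos.ne'
  have h1 : Witt.geom (Nat.card k : K) * ζ (tate k) = 1 := by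
    rw [← zetaHom_lef hζ, ← map_mul, lef_mul_tate, map_one]
  have h2 : Witt.geom (Nat.card k : K) * Witt.geom (Nat.card k : K)⁻¹ = 1 := by
    rw [Witt.geom_mul_geom, mul_inv_cancel₀ hq]; rfl
  exact (isUnit_geom hq).mul_left_cancel (h1.trans h2.symm)

end Zeta

end WittZeta

open WittZeta
theorem corollary6p6 (k : Type u) [Field k] [Finite k]
    (K : Type v) [NormedField K] [CharZero K] :
    -- `𝒯_{W,q}` and `𝒯_{W,q⁻¹}` are Rota--Baxter operators of weight one for the convolution
    IsRotaBaxter Witt.conv 1 (wittQIntegral (Nat.card k : K)) ∧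
    IsRotaBaxter Witt.conv 1 (wittQIntegral (Nat.card k : K)⁻¹) ∧
    -- the zeta function factors uniquely as a ring homomorphism from `K₀[𝕃⁻¹]`
    (∃! ζ : K0Loc k →+* Witt K, ∀ X : FTScheme k, ζ (cls X) = zeta K X) ∧
    -- and for this homomorphism the two product formulas hold
    ∀ ζ : K0Loc k →+* Witt K, (∀ X : FTScheme k, ζ (cls X) = zeta K X) →
      ∀ X : FTScheme k,
        (‖(Nat.card k : K)‖ < 1 →
          HasProd (fun m : ℕ+ => (ζ (cls X * lef k ^ (m : ℕ))).series)
            (wittQIntegral (Nat.card k : K) (zeta K X)).series) ∧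
        (1 < ‖(Nat.card k : K)‖ →
          HasProd (fun m : ℕ+ => (ζ (cls X * tate k ^ (m : ℕ))).series)
            (wittQIntegral (Nat.card k : K)⁻¹ (zeta K X)).series) := by
  have hq : 1 < Nat.card k := Finite.one_lt_card
  refine ⟨isRotaBaxter_wittQIntegral _ (natCast_pow_ne_one hq),
    isRotaBaxter_wittQIntegral _ fun n hn => ?_, existsUnique_zetaHom k K, fun ζ hζ X =>
    ⟨fun h => ?_, fun h => ?_⟩⟩
  · rw [inv_pow, ne_eq, inv_eq_one]
    exact natCast_pow_ne_one hq n hn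
  · simp only [map_mul, map_pow, hζ, zetaHom_lef hζ]
    exact hasProd_wittQIntegral h _
  · simp only [map_mul, map_pow, hζ, zetaHom_tate hζ]
    exact hasProd_wittQIntegral (by rw [norm_inv]; exact inv_lt_one_of_one_lt₀ h) _
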